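/- Let $p$ and $K$ be real numbers. For each $N\ge 1$ let $w_N=(w^{(N)}_{i,j})_{1\le i,j\le N}$ be an $N\times N$ array of independent real random variables with mean $0$, variance $1$ and $\mathbb{E}|w^{(N)}_{i,j}|^p<K$ for all $i,j$, where $p$ and $K$ do not depend on $N,i,j$. All the arrays are defined on one probability space $(\Omega,\mathbb{P}_w)$; nothing is assumed about the joint distribution of arrays of different sizes. For $\omega\in\Omega$ let $\mu_{N,\omega}$ be the quenched law of $$W_N=\frac{1}{\sqrt N}\sum_{i=1}^N w^{(N)}_{i,\pi(i)},$$ that is, the law of this sum when the weights $w^{(N)}_{i,j}=w^{(N)}_{i,j}(\omega)$ are held fixed and $\pi$ is a uniformly random permutation of $\{1,\dots,N\}$. (1) If $p>4$, then $W_N$ converges weakly in probability to $\mathcal{N}(0,1)$ as $N\to\infty$: for every bounded continuous $f:\mathbb{R}\to\mathbb{R}$ and every $\epsilon>0$, $$\mathbb{P}_w\left[\left|\int f\,d\mu_{N,\omega}-\int f\,d\mathcal{N}(0,1)\right|>\epsilon\right]\to 0 .$$ (2) If $p>6$, then for $\mathbb{P}_w$-almost every $\omega$ the measures $\mu_{N,\omega}$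 converge weakly to $\mathcal{N}(0,1)$ as $N\to\infty$, i.e. $W_N$ converges in distribution to $\mathcal{N}(0,1)$, $\mathbb{P}_w$-almost surely. -/

import Mathlib

open MeasureTheory ProbabilityTheory Filter Topology
open scoped BoundedContinuousFunction

noncomputable section

/-- The normalized sum `N^{-1/2} ∑ i, w i (π i)` of an `N × N` array along the permutation `π`. -/
def permSum {N : ℕ} (w : Fin N → Fin N → ℝ) (π : Equiv.Perm (Fin N)) : ℝ :=
  (1 / Real.sqrt N) * ∑ i, w i (π i)

/-- The law of `permSum w π` for a fixed (deterministic) array `w`, when `π` is a uniformly random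
permutation: the only randomness is that of `π`. -/
def quenchedLaw {N : ℕ} (w : Fin N → Fin N → ℝ) : ProbabilityMeasure ℝ :=
  ⟨((PMF.uniformOfFintype (Equiv.Perm (Fin N))).map (permSum w)).toMeasure, inferInstance⟩

/-- The standard normal distribution `𝒩(0, 1)`. -/
def stdNormal : ProbabilityMeasure ℝ :=
  ⟨gaussianReal 0 1, inferInstance⟩

/-- Weak convergence in probability of the random probability measures `μ N` (defined on the
probability space `(Ω, P)`) to the probability measure `ν`. The test functions are the bounded
continuous functions. -/
def ConvergesWIP {Ω : Type*} [MeasurableSpace Ω] (P : Measure Ω)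
    (μ : ℕ → Ω → ProbabilityMeasure ℝ) (ν : ProbabilityMeasure ℝ) : Prop :=
  ∀ f : ℝ →ᵇ ℝ, ∀ ε : ℝ, 0 < ε →
    Tendsto
      (fun N : ℕ => P {ω | ε < |(∫ x, f x ∂(μ N ω : Measure ℝ)) - ∫ x, f x ∂(ν : Measure ℝ)|})
      atTop (𝓝 0)

end

/-! Both parts follow from one almost sure statement that uses only a uniform bound on fourth
moments.

For a Lipschitz `h`, the quenched average of `h(W_N)` is a function of the `N²` independent weights.
A given entry is used by only a fraction `1/N` of the permutations, so this function is Lipschitz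
for the `ℓ¹` distance with constant of order `N^{-3/2}` (`abs_permAvg_sub_le`). A martingale-type
fourth-moment inequality (`exists_integral_sub_pow_four_le`) then bounds its centred fourth moment
by a multiple of `(N²)² (N^{-3/2})⁴ = N^{-2}`. This is summable, so the quenched average minus its
annealed mean tends to `0` almost surely, whatever the joint law of the different arrays.

With `h = cos(t·)` and `h = sin(t·)` this reduces the quenched characteristic function to the
annealed one. The annealed one is an average over `π` of products of `N` characteristic functions at
`t/√N`, each within `O(N^{-3/2})` of the Gaussian factor (`tendsto_integral_charFun_quenchedLaw`).
With `h = |·|` it bounds the quenched first absolute moments, so the characteristic functions are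
eventually uniformly Lipschitz in `t`. Convergence at rational `t` therefore extends to all `t`, and
Lévy's continuity theorem concludes (`ae_tendsto_quenchedLaw`). -/

lemma Fin.measurable_cons_real {n : ℕ} :
    Measurable (fun q : ℝ × (Fin n → ℝ) => (Fin.cons q.1 q.2 : Fin (n + 1) → ℝ)) := by
  refine measurable_pi_lambda _ fun i => ?_
  refine Fin.cases ?_ (fun j => ?_) i
  · simpa using measurable_fst
  · simp only [Fin.cons_succ]; fun_prop

lemma MeasureTheory.MemLp.integrable_pow_of_le {α : Type*} [MeasurableSpace α] {μ : Measure α}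
    [IsFiniteMeasure μ] {f : α → ℝ} {k n : ℕ} (hk : k ≠ 0) (hkn : k ≤ n) (hf : MemLp f n μ) :
    Integrable (fun x => |f x| ^ k) μ := by
  have := (hf.mono_exponent (p := k) (by exact_mod_cast hkn)).integrable_norm_pow hk
  simpa using this

/-! ### Moments after adding one independent coordinate. -/

section ProductStep

variable {X Y : Type*} [MeasurableSpace X] [MeasurableSpace Y] {ν : Measure X} {ρ : Measure Y}
  [IsProbabilityMeasure ρ] {F : X × Y → ℝ} {u : X → ℝ}

lemma integrable_mul_fiberDeviation [SFinite ν] (hF : Measurable F) {k : ℕ} {M : Y → ℝ} (hu : Integrable u ν)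
    (hM : MemLp M 4 ρ) (hk : k ≤ 3) {G : Y → ℝ} (hG : AEStronglyMeasurable G ρ)
    (hFu : ∀ x y, |F (x, y) - G y| ≤ u x) :
    Integrable (fun q : X × Y => M q.2 ^ k * (F q - G q.2)) (ν.prod ρ) := by
  have hMk : Integrable (fun y => |M y| ^ k) ρ := by
    rcases Nat.eq_zero_or_pos k with rfl | hk0
    · simp
    · exact hM.integrable_pow_of_le (n := 4) hk0.ne' (by omega)
  refine (hu.mul_prod hMk).mono' ?_ (Eventually.of_forall fun q => ?_)
  · exact ((hM.1.comp_snd (ν := ρ)).pow k).mul (hF.aestronglyMeasurable.sub hG.comp_snd)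
  · rw [norm_mul, norm_pow, Real.norm_eq_abs, Real.norm_eq_abs, mul_comm]
    exact mul_le_mul_of_nonneg_right (hFu q.1 q.2) (by positivity)

/-- Martingale-difference orthogonality: `G` is the conditional mean of `F` given `y`, so by Fubini
the inner integral over `x` vanishes for each `y`. -/
lemma integral_mul_fiberDeviation_eq_zero [IsProbabilityMeasure ν] (hF : Measurable F) {k : ℕ} {M : Y → ℝ}
    (hu : Integrable u ν) (hM : MemLp M 4 ρ) (hk : k ≤ 3) {G : Y → ℝ}
    (hG : AEStronglyMeasurable G ρ) (hFint : ∀ y, Integrable (fun x => F (x, y)) ν)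
    (hGF : ∀ y, G y = ∫ x, F (x, y) ∂ν) (hFu : ∀ x y, |F (x, y) - G y| ≤ u x) :
    ∫ q : X × Y, M q.2 ^ k * (F q - G q.2) ∂(ν.prod ρ) = 0 := by
  rw [integral_prod_symm _ (integrable_mul_fiberDeviation hF hu hM hk hG hFu)]
  simp_rw [integral_const_mul]
  have : ∀ y, ∫ x, (F (x, y) - G y) ∂ν = 0 := fun y => by
    rw [integral_sub (hFint y) (integrable_const _), hGF y]; simp
  simp [this]

/-- Adding one independent coordinate increases the centred second moment by at most `a` and the
centred fourth moment by at most `8 a` times the second moment plus `3 a²`. -/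
theorem centred_moments_prod_le [IsProbabilityMeasure ν] (hF : Measurable F) {G : Y → ℝ} (hG : MemLp G 4 ρ)
    (hu : MemLp u 4 ν) (hFint : ∀ y, Integrable (fun x => F (x, y)) ν)
    (hGF : ∀ y, G y = ∫ x, F (x, y) ∂ν) (hFu : ∀ x y, |F (x, y) - G y| ≤ u x) {a : ℝ}
    (hu2 : ∫ x, u x ^ 2 ∂ν ≤ a) (hu4 : ∫ x, u x ^ 4 ∂ν ≤ a ^ 2) :
    ∫ q, F q ∂(ν.prod ρ) = ∫ y, G y ∂ρ ∧
    ∫ q, (F q - ∫ y, G y ∂ρ) ^ 2 ∂(ν.prod ρ) ≤ ∫ y, (G y - ∫ y, G y ∂ρ) ^ 2 ∂ρ + a ∧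
    ∫ q, (F q - ∫ y, G y ∂ρ) ^ 4 ∂(ν.prod ρ) ≤ ∫ y, (G y - ∫ y, G y ∂ρ) ^ 4 ∂ρ
      + 8 * a * ∫ y, (G y - ∫ y, G y ∂ρ) ^ 2 ∂ρ + 3 * a ^ 2 := by
  have hGi : Integrable G ρ := hG.integrable (by norm_num)
  have hui : Integrable u ν := hu.integrable (by norm_num)
  set e := ∫ y, G y ∂ρ with he
  have hM : MemLp (fun y => G y - e) 4 ρ := hG.sub (memLp_const e)
  have hD0 := integrable_mul_fiberDeviation (k := 0) hF hui hM (by norm_num) hG.1 hFu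
  have hD1 := integrable_mul_fiberDeviation (k := 1) hF hui hM (by norm_num) hG.1 hFu
  have hD3 := integrable_mul_fiberDeviation (k := 3) hF hui hM (by norm_num) hG.1 hFu
  have z0 := integral_mul_fiberDeviation_eq_zero (k := 0) hF hui hM (by norm_num) hG.1 hFint hGF hFu
  have z1 := integral_mul_fiberDeviation_eq_zero (k := 1) hF hui hM (by norm_num) hG.1 hFint hGF hFu
  have z3 := integral_mul_fiberDeviation_eq_zero (k := 3) hF hui hM (by norm_num) hG.1 hFint hGF hFu
  have u2 : Integrable (fun x => u x ^ 2) ν := by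
    simpa using hu.integrable_pow_of_le (k := 2) (n := 4) (by norm_num) (by norm_num)
  have u4 : Integrable (fun x => u x ^ 4) ν := by
    simpa [show ∀ z : ℝ, |z| ^ 4 = z ^ 4 from fun z => by
      rw [← abs_pow, abs_of_nonneg (by positivity)]] using
      hu.integrable_pow_of_le (k := 4) (n := 4) (by norm_num) (by norm_num)
  have m2 : Integrable (fun y => (G y - e) ^ 2) ρ := by
    simpa using hM.integrable_pow_of_le (k := 2) (n := 4) (by norm_num) (by norm_num)
  have m4 : Integrable (fun y => (G y - e) ^ 4) ρ := by
    simpa [show ∀ z : ℝ, |z| ^ 4 = z ^ 4 from fun z => by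
      rw [← abs_pow, abs_of_nonneg (by positivity)]] using
      hM.integrable_pow_of_le (k := 4) (n := 4) (by norm_num) (by norm_num)
  have hu0 : ∀ x y, (F (x, y) - G y) ^ 2 ≤ u x ^ 2 := fun x y =>
    sq_le_sq' (abs_le.1 (hFu x y)).1 (abs_le.1 (hFu x y)).2
  have hI2 : ∫ q : X × Y, (G q.2 - e) ^ 2 ∂(ν.prod ρ) = ∫ y, (G y - e) ^ 2 ∂ρ := by
    simpa using integral_fun_snd (μ := ν) (ν := ρ) (fun y => (G y - e) ^ 2)
  have hI4 : ∫ q : X × Y, (G q.2 - e) ^ 4 ∂(ν.prod ρ) = ∫ y, (G y - e) ^ 4 ∂ρ := by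
    simpa using integral_fun_snd (μ := ν) (ν := ρ) (fun y => (G y - e) ^ 4)
  have hU2 : ∫ q : X × Y, u q.1 ^ 2 ∂(ν.prod ρ) = ∫ x, u x ^ 2 ∂ν := by
    simpa using integral_fun_fst (μ := ν) (ν := ρ) (fun y => u y ^ 2)
  have hU4 : ∫ q : X × Y, u q.1 ^ 4 ∂(ν.prod ρ) = ∫ x, u x ^ 4 ∂ν := by
    simpa using integral_fun_fst (μ := ν) (ν := ρ) (fun y => u y ^ 4)
  have i2 := m2.comp_snd ν
  have i4 := m4.comp_snd ν
  have j2 := u2.comp_fst ρ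
  have j4 := u4.comp_fst ρ
  have i22 := u2.mul_prod m2
  have hU22 : ∫ q : X × Y, u q.1 ^ 2 * (G q.2 - e) ^ 2 ∂(ν.prod ρ)
      = (∫ x, u x ^ 2 ∂ν) * ∫ y, (G y - e) ^ 2 ∂ρ :=
    integral_prod_mul (fun x => u x ^ 2) (fun y => (G y - e) ^ 2)
  refine ⟨?_, ?_, ?_⟩
  · have : ∀ q : X × Y, F q = G q.2 + (G q.2 - e) ^ 0 * (F q - G q.2) := fun q => by ring
    rw [integral_congr_ae (Eventually.of_forall this), integral_add (hGi.comp_snd ν) hD0, z0,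
      add_zero]
    simpa using integral_fun_snd (μ := ν) (ν := ρ) G
  · calc ∫ q, (F q - e) ^ 2 ∂(ν.prod ρ)
        ≤ ∫ q : X × Y, ((G q.2 - e) ^ 2 + 2 * ((G q.2 - e) ^ 1 * (F q - G q.2)) + u q.1 ^ 2)
          ∂(ν.prod ρ) := by
          refine integral_mono_of_nonneg (Eventually.of_forall fun q => by positivity)
            ((i2.fun_add (hD1.const_mul 2)).add j2) (Eventually.of_forall fun q => ?_)
          have := hu0 q.1 q.2
          simp only [Prod.mk.eta] at this
          dsimp only
          nlinarith
      _ = ∫ y, (G y - e) ^ 2 ∂ρ + ∫ x, u x ^ 2 ∂ν := by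
          rw [integral_add (i2.fun_add (hD1.const_mul 2)) j2, integral_add i2 (hD1.const_mul 2),
            integral_const_mul, z1, hI2, hU2]; ring
      _ ≤ _ := by gcongr
  · calc ∫ q, (F q - e) ^ 4 ∂(ν.prod ρ)
        ≤ ∫ q : X × Y, ((G q.2 - e) ^ 4 + 4 * ((G q.2 - e) ^ 3 * (F q - G q.2))
          + 8 * (u q.1 ^ 2 * (G q.2 - e) ^ 2) + 3 * u q.1 ^ 4) ∂(ν.prod ρ) := by
          refine integral_mono_of_nonneg (Eventually.of_forall fun q => by positivity)
            (((i4.fun_add (hD3.const_mul 4)).fun_add (i22.const_mul 8)).add (j4.const_mul 3))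
            (Eventually.of_forall fun q => ?_)
          have h1 := hu0 q.1 q.2
          simp only [Prod.mk.eta] at h1
          dsimp only
          generalize u q.1 = v at h1 ⊢
          obtain ⟨m, hm⟩ : ∃ m, m = G q.2 - e := ⟨_, rfl⟩
          obtain ⟨d, hd⟩ : ∃ d, d = F q - G q.2 := ⟨_, rfl⟩
          have hF' : F q - e = m + d := by rw [hm, hd]; ring
          rw [hF', ← hm, ← hd]
          rw [← hd] at h1
          have h2 : d ^ 2 * m ^ 2 ≤ v ^ 2 * m ^ 2 := by gcongr
          have h3 : d ^ 4 ≤ v ^ 4 := by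
            have := pow_le_pow_left₀ (sq_nonneg d) h1 2
            nlinarith
          -- In the expansion of `(m + d)⁴`, the term `4 m d³` is at most `2 m² d² + 2 d⁴`; this
          -- turns the coefficients 6 and 1 into 8 and 3. The term `4 m³ d` is kept, since it
          -- integrates to zero.
          nlinarith [mul_nonneg (sq_nonneg d) (sq_nonneg (m - d))]
      _ = ∫ y, (G y - e) ^ 4 ∂ρ + 8 * ((∫ x, u x ^ 2 ∂ν) * ∫ y, (G y - e) ^ 2 ∂ρ)
          + 3 * ∫ x, u x ^ 4 ∂ν := by
          rw [integral_add ((i4.fun_add (hD3.const_mul 4)).fun_add (i22.const_mul 8)) (j4.const_mul 3),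
            integral_add (i4.fun_add (hD3.const_mul 4)) (i22.const_mul 8),
            integral_add i4 (hD3.const_mul 4), integral_const_mul, integral_const_mul,
            integral_const_mul, z3, hI4, hU4, hU22]; ring
      _ ≤ _ := by
          have h0 : 0 ≤ ∫ y, (G y - e) ^ 2 ∂ρ := integral_nonneg fun y => by positivity
          have := mul_le_mul_of_nonneg_right hu2 h0
          nlinarith

end ProductStep

/-! ### Fourth-moment concentration on product spaces. -/

section Pi

variable {n : ℕ} {μ : Fin n → Measure ℝ} [∀ i, IsProbabilityMeasure (μ i)] {F : (Fin n → ℝ) → ℝ}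
  {c : ℝ}

lemma continuous_of_abs_sub_le_sum {ι : Type*} [Fintype ι] {F : (ι → ℝ) → ℝ} {c : ℝ}
    (hF : ∀ x y, |F x - F y| ≤ c * ∑ i, |x i - y i|) : Continuous F := by
  rw [continuous_iff_continuousAt]
  intro y
  rw [ContinuousAt, tendsto_iff_dist_tendsto_zero]
  refine squeeze_zero (fun _ => dist_nonneg) (fun x => hF x y) ?_
  have : Continuous (fun x : ι → ℝ => c * ∑ i, |x i - y i|) := by fun_prop
  simpa using this.tendsto y

lemma memLp_pi_of_abs_sub_le_sum (hμ : ∀ i, MemLp id 4 (μ i))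
    (hF : ∀ x y, |F x - F y| ≤ c * ∑ i, |x i - y i|) : MemLp F 4 (Measure.pi μ) := by
  have h1 : MemLp (fun x : Fin n → ℝ => |F 0| + c * ∑ i, |x i|) 4 (Measure.pi μ) := by
    have h0 : ∀ i, MemLp (fun x : Fin n → ℝ => |x i|) 4 (Measure.pi μ) := fun i =>
      ((hμ i).comp_measurePreserving (measurePreserving_eval μ i)).abs
    have h2 : MemLp (fun x : Fin n → ℝ => ∑ i, |x i|) 4 (Measure.pi μ) :=
      memLp_finsetSum _ fun i _ => h0 i
    exact (memLp_const |F 0|).add (h2.const_mul c)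
  refine h1.mono' (continuous_of_abs_sub_le_sum hF).aestronglyMeasurable
    (Eventually.of_forall fun x => ?_)
  have := hF x 0
  simp only [Pi.zero_apply, sub_zero] at this
  rw [Real.norm_eq_abs]
  calc |F x| = |F 0 + (F x - F 0)| := by ring_nf
    _ ≤ _ := (abs_add_le _ _).trans (by gcongr)

end Pi

/-- Induction on the number of coordinates: integrating out the first one leaves a function `G` of
the others with the same Lipschitz constant. With `a = c² A`, each step adds at most `a` to the
second moment, and the fourth closes because `4n² + 8n + 3 ≤ 4(n + 1)²`. -/
theorem centred_moments_pi_le {m A c : ℝ} (hA : 1 ≤ A) (hc : 0 ≤ c) {n : ℕ} :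
    ∀ (μ : Fin n → Measure ℝ) [∀ i, IsProbabilityMeasure (μ i)], (∀ i, MemLp id 4 (μ i)) →
    (∀ i, ∫ x, |x| ∂(μ i) ≤ m) → (∀ i, ∫ x, (|x| + m) ^ 2 ∂(μ i) ≤ A) →
    (∀ i, ∫ x, (|x| + m) ^ 4 ∂(μ i) ≤ A) →
    ∀ F : (Fin n → ℝ) → ℝ, (∀ x y, |F x - F y| ≤ c * ∑ i, |x i - y i|) →
    ∫ x, (F x - ∫ y, F y ∂(Measure.pi μ)) ^ 2 ∂(Measure.pi μ) ≤ n * (c ^ 2 * A) ∧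
    ∫ x, (F x - ∫ y, F y ∂(Measure.pi μ)) ^ 4 ∂(Measure.pi μ) ≤ 4 * n ^ 2 * (c ^ 2 * A) ^ 2 := by
  induction n with
  | zero =>
    intro μ _ _ _ _ _ F _
    have : ∀ x : Fin 0 → ℝ, F x = F 0 := fun x => by rw [Subsingleton.elim x 0]
    simp [this]
  | succ n ih =>
    intro μ _ hμ hm h2 h4 F hF
    set ν := μ 0
    set ρ : Measure (Fin n → ℝ) := Measure.pi fun j => μ j.succ
    let F' : ℝ × (Fin n → ℝ) → ℝ := fun q => F (Fin.cons q.1 q.2)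
    let G : (Fin n → ℝ) → ℝ := fun y => ∫ x, F' (x, y) ∂ν
    have hFc := continuous_of_abs_sub_le_sum hF
    have hF'm : Measurable F' := hFc.measurable.comp Fin.measurable_cons_real
    have hν1 : Integrable (fun x : ℝ => |x|) ν := ((hμ 0).integrable (by norm_num)).abs
    have hx : ∀ x x' y, |F' (x, y) - F' (x', y)| ≤ c * |x - x'| := fun x x' y => by
      simpa [F', Fin.sum_univ_succ] using hF (Fin.cons x y) (Fin.cons x' y)
    have hy : ∀ x y y', |F' (x, y) - F' (x, y')| ≤ c * ∑ i, |y i - y' i| := fun x y y' => by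
      simpa [F', Fin.sum_univ_succ] using hF (Fin.cons x y) (Fin.cons x y')
    have hFint : ∀ y, Integrable (fun x => F' (x, y)) ν := fun y => by
      refine ((integrable_const |F' (0, y)|).add (hν1.const_mul c)).mono'
        (hF'm.comp measurable_prodMk_right).aestronglyMeasurable
        (Eventually.of_forall fun x => ?_)
      have := hx x 0 y
      rw [sub_zero] at this
      calc |F' (x, y)| = |F' (0, y) + (F' (x, y) - F' (0, y))| := by ring_nf
        _ ≤ |F' (0, y)| + c * |x| := (abs_add_le _ _).trans (by gcongr)
    have hGlip : ∀ y y', |G y - G y'| ≤ c * ∑ i, |y i - y' i| := fun y y' => by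
      rw [← integral_sub (hFint y) (hFint y'), ← Real.norm_eq_abs]
      refine (norm_integral_le_of_norm_le_const (C := c * ∑ i, |y i - y' i|)
        (Eventually.of_forall fun x => hy x y y')).trans ?_
      simp
    have hG : MemLp G 4 ρ := memLp_pi_of_abs_sub_le_sum (fun j => hμ j.succ) hGlip
    -- `G y` averages over an independent copy `x'` of the first coordinate, and `|x - x'| ≤ |x| +
    -- |x'|`.
    have hFu : ∀ x y, |F' (x, y) - G y| ≤ c * (|x| + m) := fun x y => by
      have h1 : F' (x, y) - G y = ∫ x', (F' (x, y) - F' (x', y)) ∂ν := by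
        rw [integral_sub (integrable_const _) (hFint y)]; simp [G]
      rw [h1, ← Real.norm_eq_abs]
      calc _ ≤ ∫ x', c * (|x| + |x'|) ∂ν := by
            refine norm_integral_le_of_norm_le
              (((integrable_const |x|).fun_add hν1).const_mul c)
              (Eventually.of_forall fun x' => (hx x x' y).trans ?_)
            gcongr
            exact abs_sub _ _
        _ = c * (|x| + ∫ x', |x'| ∂ν) := by
            rw [integral_const_mul, integral_add (integrable_const _) hν1]; simp
        _ ≤ _ := by gcongr; exact hm 0
    have hu : MemLp (fun x : ℝ => c * (|x| + m)) 4 ν :=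
      MemLp.const_mul ((hμ 0).abs.add (memLp_const m)) c
    obtain ⟨e1, e2, e4⟩ := centred_moments_prod_le (a := c ^ 2 * A) hF'm hG hu hFint
      (fun y => rfl) hFu
      (by simp_rw [mul_pow]; rw [integral_const_mul]; gcongr; exact h2 0)
      (by
        simp_rw [mul_pow]; rw [integral_const_mul, ← pow_mul]; gcongr
        -- `A ≤ A²` because `1 ≤ A`, so a single constant serves both moments.
        exact (h4 0).trans (by nlinarith))
    obtain ⟨g2, g4⟩ := ih (fun j => μ j.succ) (fun j => hμ _) (fun j => hm _) (fun j => h2 _)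
      (fun j => h4 _) G hGlip
    have hmp := (measurePreserving_piFinSuccAbove μ 0).symm
    have key : ∀ H : (Fin (n + 1) → ℝ) → ℝ,
        ∫ x, H x ∂(Measure.pi μ) = ∫ q, H (Fin.cons q.1 q.2) ∂(ν.prod ρ) := fun H => by
      have h := hmp.integral_comp' H
      rw [← h]
      simp [ν, ρ, MeasurableEquiv.piFinSuccAbove_symm_apply, Fin.insertNthEquiv]
    have hE : ∫ y, F y ∂(Measure.pi μ) = ∫ y, G y ∂ρ := (key F).trans e1
    rw [hE, key, key]
    push_cast
    refine ⟨e2.trans (by linarith), e4.trans ?_⟩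
    have ha : 0 ≤ c ^ 2 * A := by positivity
    have := mul_le_mul_of_nonneg_left g2 ha
    nlinarith

/-- Fourth-moment concentration: a function of independent random variables that is
`c`-Lipschitz for the `ℓ¹` distance has a centred fourth moment of order `n² c⁴`. -/
theorem exists_integral_sub_pow_four_le (B : ℝ) : ∃ C : ℝ, 0 ≤ C ∧
    ∀ {Ω : Type*} [MeasurableSpace Ω] (P : Measure Ω) [IsProbabilityMeasure P]
    {ι : Type} [Fintype ι] (X : ι → Ω → ℝ), (∀ i, Measurable (X i)) → iIndepFun X P →
    (∀ i, MemLp (X i) 4 P) → (∀ i, ∫ ω, X i ω ^ 4 ∂P ≤ B) →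
    ∀ {c : ℝ}, 0 ≤ c → ∀ F : (ι → ℝ) → ℝ, (∀ x y, |F x - F y| ≤ c * ∑ i, |x i - y i|) →
    Integrable (fun ω => F fun i => X i ω) P ∧
    Integrable (fun ω => (F (fun i => X i ω) - ∫ ω, F (fun i => X i ω) ∂P) ^ 4) P ∧
    ∫ ω, (F (fun i => X i ω) - ∫ ω, F (fun i => X i ω) ∂P) ^ 4 ∂P
      ≤ C * (Fintype.card ι) ^ 2 * c ^ 4 := by
  -- `m` bounds the first absolute moments through `|x| ≤ 1 + x⁴`. `A` bounds the moments of `|x| +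
  -- m` through `(|x| + m)⁴ ≤ 8 m⁴ + 8 x⁴` and `y² ≤ 1 + y⁴`. The absolute value covers negative
  -- `B`, which is possible when `ι` is empty.
  set m : ℝ := 1 + |B|
  set A : ℝ := 1 + 8 * |B| + 8 * m ^ 4
  refine ⟨4 * A ^ 2, by positivity, ?_⟩
  intro Ω _ P _ ι _ X hX hind h4 hB c hc F hF
  let e := (Fintype.equivFin ι).symm
  set n := Fintype.card ι
  let μ : Fin n → Measure ℝ := fun i => P.map (X (e i))
  have : ∀ i, IsProbabilityMeasure (μ i) := fun i =>
    Measure.isProbabilityMeasure_map (hX _).aemeasurable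
  have hmap : P.map (fun ω i => X (e i) ω) = Measure.pi μ :=
    (iIndepFun_iff_map_fun_eq_pi_map fun i => (hX (e i)).aemeasurable).1
      (hind.precomp e.injective)
  have hμ : ∀ i, MemLp id 4 (μ i) := fun i =>
    (memLp_map_measure_iff aestronglyMeasurable_id (hX _).aemeasurable).2 (h4 (e i))
  let F' : (Fin n → ℝ) → ℝ := fun x => F fun i => x (e.symm i)
  have hF' : ∀ x y, |F' x - F' y| ≤ c * ∑ i, |x i - y i| := fun x y => by
    refine (hF _ _).trans (le_of_eq ?_)
    rw [e.symm.sum_comp fun i => |x i - y i|]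
  have hFX : ∀ ω, F (fun i => X i ω) = F' (fun i => X (e i) ω) := fun ω => by simp [F']
  have hmeas : AEMeasurable (fun ω i => X (e i) ω) P :=
    (measurable_pi_lambda _ fun i => hX _).aemeasurable
  have hF'c := continuous_of_abs_sub_le_sum hF'
  have hcomp : ∀ H : (Fin n → ℝ) → ℝ, Continuous H →
      ∫ ω, H (fun i => X (e i) ω) ∂P = ∫ x, H x ∂(Measure.pi μ) := fun H hH => by
    rw [← hmap, integral_map hmeas hH.aestronglyMeasurable]
  have q4 : ∀ i, Integrable (fun x : ℝ => |x| ^ 4) (μ i) := fun i =>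
    (hμ i).integrable_pow_of_le (k := 4) (n := 4) (by norm_num) (by norm_num)
  have b4 : ∀ i, ∫ x, |x| ^ 4 ∂(μ i) ≤ |B| := fun i => by
    rw [integral_map (hX _).aemeasurable (by fun_prop)]
    simp only [← abs_pow]
    refine le_trans (le_of_eq ?_) ((hB (e i)).trans (le_abs_self B))
    exact integral_congr_ae (Eventually.of_forall fun ω => abs_of_nonneg (by positivity))
  have hbound : ∀ (k : ℝ → ℝ) (a b : ℝ), (∀ x, 0 ≤ k x) → 0 ≤ b → (∀ x, k x ≤ a + b * |x| ^ 4) →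
      ∀ i, ∫ x, k x ∂(μ i) ≤ a + b * |B| := fun k a b hk hb hkab i => by
    calc _ ≤ ∫ x, (a + b * |x| ^ 4) ∂(μ i) :=
          integral_mono_of_nonneg (Eventually.of_forall hk)
            ((integrable_const _).add ((q4 i).const_mul b)) (Eventually.of_forall hkab)
      _ = a + b * ∫ x, |x| ^ 4 ∂(μ i) := by
          rw [integral_add (integrable_const _) ((q4 i).const_mul b), integral_const_mul]; simp
      _ ≤ _ := by gcongr; exact b4 i
  have hm0 : 0 ≤ m := by positivity
  have hpow4 : ∀ x : ℝ, (|x| + m) ^ 4 ≤ 8 * m ^ 4 + 8 * |x| ^ 4 := fun x => by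
    have h := pow_le_pow_left₀ (by positivity) (show (|x| + m) ^ 2 ≤ 2 * |x| ^ 2 + 2 * m ^ 2 by
      nlinarith [sq_nonneg (|x| - m)]) 2
    nlinarith [sq_nonneg (|x| ^ 2 - m ^ 2)]
  obtain ⟨-, key⟩ := centred_moments_pi_le (m := m) (A := A) (c := c)
    (by simp only [A]; nlinarith [abs_nonneg B, pow_nonneg hm0 4]) hc μ hμ
    (fun i => (hbound (fun x => |x|) 1 1 (fun x => abs_nonneg x) zero_le_one (fun x => by
      nlinarith [sq_nonneg (|x| ^ 2 - 1), sq_nonneg (|x| - 1), abs_nonneg x]) i).trans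
        (by simp [m]))
    (fun i => (hbound (fun x => (|x| + m) ^ 2) (1 + 8 * m ^ 4) 8 (fun x => by positivity)
      (by norm_num) (fun x => by
        nlinarith [hpow4 x, sq_nonneg ((|x| + m) ^ 2 - 1)]) i).trans (by simp only [A]; linarith))
    (fun i => (hbound (fun x => (|x| + m) ^ 4) (8 * m ^ 4) 8 (fun x => by positivity)
      (by norm_num) (fun x => by linarith [hpow4 x]) i).trans (by simp only [A]; linarith))
    F' hF'
  have hL : MemLp F' 4 (Measure.pi μ) := memLp_pi_of_abs_sub_le_sum hμ hF'
  have hLP : MemLp (fun ω => F fun i => X i ω) 4 P := by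
    simp_rw [hFX]
    rw [← hmap] at hL
    exact hL.comp_of_map hmeas
  refine ⟨hLP.integrable (by norm_num), ?_, ?_⟩
  · have := (hLP.sub (memLp_const (∫ ω, F (fun i => X i ω) ∂P))).integrable_pow_of_le (k := 4)
      (n := 4) (by norm_num) (by norm_num)
    refine this.congr (Eventually.of_forall fun ω => ?_)
    dsimp only [Pi.sub_apply]
    rw [← abs_pow, abs_of_nonneg (by positivity)]
  · simp_rw [hFX]
    rw [hcomp F' hF'c, hcomp (fun x => (F' x - ∫ x, F' x ∂(Measure.pi μ)) ^ 4) (by fun_prop)]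
    exact key.trans (le_of_eq (by ring))

/-! ### Quenched averages and their concentration. -/

/-- The average of `h (permSum w π)` over all permutations `π`. -/
noncomputable def permAvg {N : ℕ} (h : ℝ → ℝ) (w : Fin N → Fin N → ℝ) : ℝ :=
  (Fintype.card (Equiv.Perm (Fin N)) : ℝ)⁻¹ * ∑ π, h (permSum w π)

lemma integral_quenchedLaw {E : Type*} [NormedAddCommGroup E] [NormedSpace ℝ E] [CompleteSpace E]
    {N : ℕ} (w : Fin N → Fin N → ℝ) {f : ℝ → E}
    (hsm : AEStronglyMeasurable f (quenchedLaw w : Measure ℝ)) :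
    ∫ x, f x ∂(quenchedLaw w : Measure ℝ)
      = (Fintype.card (Equiv.Perm (Fin N)) : ℝ)⁻¹ • ∑ π, f (permSum w π) := by
  let m : MeasurableSpace (Equiv.Perm (Fin N)) := ⊤
  have hm : Measurable (permSum w) := measurable_from_top
  have hmap : (quenchedLaw w : Measure ℝ)
      = ((PMF.uniformOfFintype (Equiv.Perm (Fin N))).toMeasure).map (permSum w) :=
    (PMF.toMeasure_map _ _ hm).symm
  rw [hmap] at hsm ⊢
  rw [integral_map hm.aemeasurable hsm, PMF.integral_eq_sum, Finset.smul_sum]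
  simp

lemma integral_quenchedLaw_real {N : ℕ} (w : Fin N → Fin N → ℝ) {f : ℝ → ℝ} (hf : Continuous f) :
    ∫ x, f x ∂(quenchedLaw w : Measure ℝ) = permAvg f w :=
  integral_quenchedLaw w hf.aestronglyMeasurable

/-- The image of a point under a uniform permutation is uniform. Composing with a transposition
shows that the sum over `π` does not depend on `i`; summing over all `i` makes each `π` contribute
`∑ j, f j`. -/
lemma Equiv.Perm.card_mul_sum_apply {ι : Type*} [Fintype ι] [DecidableEq ι] (f : ι → ℝ) (i : ι) :
    (Fintype.card ι : ℝ) * ∑ π : Equiv.Perm ι, f (π i)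
      = Fintype.card (Equiv.Perm ι) * ∑ j, f j := by
  have h : ∀ k, ∑ π : Equiv.Perm ι, f (π i) = ∑ π : Equiv.Perm ι, f (π k) := fun k => by
    rw [← Equiv.sum_comp (Equiv.mulRight (Equiv.swap i k))]
    simp
  calc (Fintype.card ι : ℝ) * ∑ π : Equiv.Perm ι, f (π i)
      = ∑ _k : ι, ∑ π : Equiv.Perm ι, f (π i) := by simp
    _ = ∑ k : ι, ∑ π : Equiv.Perm ι, f (π k) := Finset.sum_congr rfl fun k _ => h k
    _ = ∑ π : Equiv.Perm ι, ∑ k : ι, f (π k) := Finset.sum_comm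
    _ = ∑ _π : Equiv.Perm ι, ∑ j, f j := Finset.sum_congr rfl fun π _ => Equiv.sum_comp π f
    _ = _ := by simp

/-- For one permutation the constant would be `L / √N`. Averaging gains the factor `1 / N`, the
proportion of permutations with `π i = j`; this gain makes the concentration bound summable. -/
lemma abs_permAvg_sub_le {N : ℕ} {h : ℝ → ℝ} {L : ℝ} (hL : ∀ x y, |h x - h y| ≤ L * |x - y|)
    (w w' : Fin N → Fin N → ℝ) :
    |permAvg h w - permAvg h w'| ≤ L / (N * √N) * ∑ i, ∑ j, |w i j - w' i j| := by
  have hL0 : 0 ≤ L := by simpa using (abs_nonneg _).trans (hL 1 0)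
  rcases Nat.eq_zero_or_pos N with rfl | hN
  · have : w = w' := by ext i; exact i.elim0
    simp [this]
  have hN' : (0 : ℝ) < N := by exact_mod_cast hN
  set c : ℝ := (Fintype.card (Equiv.Perm (Fin N)) : ℝ)
  have hc : 0 < c := by simp only [c]; exact_mod_cast Fintype.card_pos
  have h1 : ∀ π : Equiv.Perm (Fin N), |h (permSum w π) - h (permSum w' π)|
      ≤ L * (1 / √N * ∑ i, |w i (π i) - w' i (π i)|) := fun π => by
    refine (hL _ _).trans (mul_le_mul_of_nonneg_left ?_ hL0)
    rw [permSum, permSum, ← mul_sub, ← Finset.sum_sub_distrib, abs_mul, abs_of_nonneg (by positivity)]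
    gcongr
    exact Finset.abs_sum_le_sum_abs _ _
  have h2 : ∑ π : Equiv.Perm (Fin N), ∑ i, |w i (π i) - w' i (π i)|
      = c / N * ∑ i, ∑ j, |w i j - w' i j| := by
    rw [Finset.sum_comm, Finset.mul_sum]
    refine Finset.sum_congr rfl fun i _ => ?_
    have := Equiv.Perm.card_mul_sum_apply (fun j => |w i j - w' i j|) i
    rw [Fintype.card_fin] at this
    field_simp
    linarith
  calc |permAvg h w - permAvg h w'|
      = c⁻¹ * |∑ π, (h (permSum w π) - h (permSum w' π))| := by
        rw [permAvg, permAvg, ← mul_sub, abs_mul, abs_of_pos (by positivity),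
          Finset.sum_sub_distrib]
    _ ≤ c⁻¹ * ∑ π : Equiv.Perm (Fin N), L * (1 / √N * ∑ i, |w i (π i) - w' i (π i)|) := by
        gcongr
        exact (Finset.abs_sum_le_sum_abs _ _).trans (Finset.sum_le_sum fun π _ => h1 π)
    _ = _ := by
        rw [← Finset.mul_sum, ← Finset.mul_sum, h2]
        field_simp

/-- By monotone convergence `∑ Z n ^ 4` has finite expectation, hence is almost surely finite and
its terms tend to zero. No joint information about the `Z n` enters. -/
lemma ae_tendsto_zero_of_summable_integral_pow_four {Ω : Type*} [MeasurableSpace Ω] {P : Measure Ω}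
    {Z : ℕ → Ω → ℝ} (hZ : ∀ n, Integrable (fun ω => Z n ω ^ 4) P) {b : ℕ → ℝ} (hb : Summable b)
    (hZb : ∀ n, ∫ ω, Z n ω ^ 4 ∂P ≤ b n) : ∀ᵐ ω ∂P, Tendsto (fun n => Z n ω) atTop (𝓝 0) := by
  have hm : ∀ n, AEMeasurable (fun ω => ENNReal.ofReal (Z n ω ^ 4)) P := fun n =>
    (hZ n).aemeasurable.ennreal_ofReal
  have h1 : ∫⁻ ω, ∑' n, ENNReal.ofReal (Z n ω ^ 4) ∂P ≠ ⊤ := by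
    rw [lintegral_tsum hm]
    refine ne_top_of_le_ne_top hb.tsum_ofReal_ne_top (ENNReal.tsum_le_tsum fun n => ?_)
    rw [← ofReal_integral_eq_lintegral_ofReal (hZ n) (Eventually.of_forall fun ω => by positivity)]
    exact ENNReal.ofReal_le_ofReal (hZb n)
  filter_upwards [ae_lt_top' (AEMeasurable.tsum hm) h1] with ω hω
  have h2 := ENNReal.tendsto_atTop_zero_of_tsum_ne_top hω.ne
  have h3 : Tendsto (fun n => Z n ω ^ 4) atTop (𝓝 0) := by
    have := (ENNReal.tendsto_toReal (ENNReal.zero_ne_top)).comp h2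
    refine this.congr fun n => ?_
    simp only [Function.comp]
    exact ENNReal.toReal_ofReal (by positivity)
  rw [tendsto_zero_iff_abs_tendsto_zero]
  have h4 := (Real.continuous_sqrt.comp Real.continuous_sqrt).tendsto 0 |>.comp h3
  simp only [Function.comp_def, Real.sqrt_zero] at h4
  refine h4.congr fun n => ?_
  rw [show Z n ω ^ 4 = (Z n ω ^ 2) ^ 2 by ring, Real.sqrt_sq (by positivity), Real.sqrt_sq_eq_abs]
  rfl

section Array

variable {Ω : Type*} [MeasurableSpace Ω] {P : Measure Ω} [IsProbabilityMeasure P]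
  {w : (N : ℕ) → Fin N → Fin N → Ω → ℝ} {B : ℝ}

/-- Quenched averages of Lipschitz functions concentrate around their annealed means. -/
theorem integrable_permAvg_and_ae_tendsto (hmeas : ∀ N i j, Measurable (w N i j))
    (hindep : ∀ N, iIndepFun (fun a : Fin N × Fin N => w N a.1 a.2) P)
    (h4 : ∀ N i j, MemLp (w N i j) 4 P) (hB : ∀ N i j, ∫ ω, w N i j ω ^ 4 ∂P ≤ B)
    {h : ℝ → ℝ} {L : ℝ} (hL : ∀ x y, |h x - h y| ≤ L * |x - y|) :
    (∀ N, Integrable (fun ω => permAvg h fun i j => w N i j ω) P) ∧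
    ∀ᵐ ω ∂P, Tendsto (fun N => permAvg h (fun i j => w N i j ω)
      - ∫ ω, permAvg h (fun i j => w N i j ω) ∂P) atTop (𝓝 0) := by
  have hL0 : 0 ≤ L := by simpa using (abs_nonneg _).trans (hL 1 0)
  obtain ⟨C, hC, key⟩ := exists_integral_sub_pow_four_le B
  have key := fun N : ℕ => key P (fun a : Fin N × Fin N => w N a.1 a.2) (fun a => hmeas N _ _)
    (hindep N) (fun a => h4 N _ _) (fun a => hB N _ _) (c := L / (N * √N)) (by positivity)
    (fun x => permAvg h fun i j => x (i, j)) (fun x y => by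
      refine (abs_permAvg_sub_le hL _ _).trans (le_of_eq ?_)
      rw [Fintype.sum_prod_type])
  refine ⟨fun N => (key N).1, ?_⟩
  refine ae_tendsto_zero_of_summable_integral_pow_four (fun N => (key N).2.1)
    (b := fun N : ℕ => C * L ^ 4 * ((N : ℝ) ^ 2)⁻¹) ?_ fun N => ((key N).2.2).trans (le_of_eq ?_)
  · exact (Real.summable_nat_pow_inv.2 (by norm_num)).mul_left _
  · rcases Nat.eq_zero_or_pos N with rfl | hN
    · simp
    have hN' : (0 : ℝ) < N := by exact_mod_cast hN
    have hs : √(N : ℝ) ^ 4 = (N : ℝ) ^ 2 := by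
      rw [show 4 = 2 * 2 by norm_num, pow_mul, Real.sq_sqrt hN'.le]
    rw [Fintype.card_prod, Fintype.card_fin, div_pow, mul_pow, hs]
    push_cast
    field_simp

end Array

/-! ### Estimates behind the Gaussian limit of characteristic functions. -/

lemma Complex.norm_exp_mul_I_sub_taylor_two_le (x : ℝ) :
    ‖Complex.exp (x * Complex.I) - (1 + x * Complex.I - x ^ 2 / 2)‖ ≤ 4 * |x| ^ 3 := by
  rcases le_total |x| 1 with hx | hx
  · have hn : ‖(x * Complex.I : ℂ)‖ = |x| := by simp
    have h := Complex.exp_bound (x := x * Complex.I) (by rw [hn]; exact hx) (n := 3) (by norm_num)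
    rw [hn] at h
    have hs : ∑ m ∈ Finset.range 3, (x * Complex.I : ℂ) ^ m / (m.factorial : ℂ)
        = 1 + x * Complex.I - x ^ 2 / 2 := by
      simp [Finset.sum_range_succ, mul_pow, Nat.factorial]
      ring
    rw [hs] at h
    refine h.trans ?_
    have : 0 ≤ |x| ^ 3 := by positivity
    norm_num [Nat.factorial]
    linarith
  · have h1 : ‖Complex.exp (x * Complex.I)‖ = 1 := Complex.norm_exp_ofReal_mul_I x
    have h2 : ‖(1 + x * Complex.I - x ^ 2 / 2 : ℂ)‖ ≤ 1 + |x| + |x| ^ 2 / 2 := by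
      refine (norm_sub_le _ _).trans (add_le_add ((norm_add_le _ _).trans ?_) ?_) <;> simp
    have h3 : |x| ≤ |x| ^ 3 := le_self_pow₀ hx (by norm_num)
    have h4 : |x| ^ 2 ≤ |x| ^ 3 := pow_le_pow_right₀ hx (by norm_num)
    refine (norm_sub_le _ _).trans ?_
    linarith

/-- Telescoping: factors are exchanged one at a time, while the others stay in the unit disc. -/
lemma norm_prod_sub_prod_le {ι : Type*} (s : Finset ι) {a b : ι → ℂ}
    (ha : ∀ i ∈ s, ‖a i‖ ≤ 1) (hb : ∀ i ∈ s, ‖b i‖ ≤ 1) :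
    ‖∏ i ∈ s, a i - ∏ i ∈ s, b i‖ ≤ ∑ i ∈ s, ‖a i - b i‖ := by
  classical
  induction s using Finset.induction_on with
  | empty => simp
  | insert i s hi ih =>
    rw [Finset.prod_insert hi, Finset.prod_insert hi, Finset.sum_insert hi]
    have e : a i * ∏ j ∈ s, a j - b i * ∏ j ∈ s, b j
        = (a i - b i) * ∏ j ∈ s, a j + b i * (∏ j ∈ s, a j - ∏ j ∈ s, b j) := by ring
    have hp : ‖∏ j ∈ s, a j‖ ≤ 1 := by
      rw [norm_prod]
      exact Finset.prod_le_one (fun _ _ => norm_nonneg _)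
        fun j hj => ha j (Finset.mem_insert_of_mem hj)
    have ih' := ih (fun j hj => ha j (Finset.mem_insert_of_mem hj))
      (fun j hj => hb j (Finset.mem_insert_of_mem hj))
    have hbi := hb i (Finset.mem_insert_self i s)
    rw [e]
    refine (norm_add_le _ _).trans (add_le_add ?_ ?_)
    · rw [norm_mul]; exact mul_le_of_le_one_right (norm_nonneg _) hp
    · rw [norm_mul]; exact (mul_le_of_le_one_left (norm_nonneg _) hbi).trans ih'

section CharFun

variable {Ω : Type*} [MeasurableSpace Ω] {P : Measure Ω} [IsProbabilityMeasure P]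

/-- Both functions agree with `1 - s²/2` up to `O(|s|³)`. The mean and variance fix the Taylor
polynomial, and `|X|³ ≤ 1 + X⁴` controls the remainder. -/
lemma norm_charFun_sub_gaussian_le {X : Ω → ℝ} {B s : ℝ} (hX : Measurable X) (h4 : MemLp X 4 P)
    (h0 : ∫ ω, X ω ∂P = 0) (h2 : ∫ ω, X ω ^ 2 ∂P = 1) (hB : ∫ ω, X ω ^ 4 ∂P ≤ B) (hs : |s| ≤ 1) :
    ‖charFun (P.map X) s - Complex.exp (-(s ^ 2) / 2)‖ ≤ (5 + 4 * B) * |s| ^ 3 := by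
  have i1 : Integrable X P := h4.integrable (by norm_num)
  have i2 : Integrable (fun ω => X ω ^ 2) P := by
    simpa using h4.integrable_pow_of_le (k := 2) (n := 4) (by norm_num) (by norm_num)
  have i4 : Integrable (fun ω => X ω ^ 4) P := by
    simpa [show ∀ z : ℝ, |z| ^ 4 = z ^ 4 from fun z => by
      rw [← abs_pow, abs_of_nonneg (by positivity)]] using
      h4.integrable_pow_of_le (k := 4) (n := 4) (by norm_num) (by norm_num)
  have ie : Integrable (fun ω => Complex.exp ((s * X ω : ℝ) * Complex.I)) P := by
    refine (integrable_const (1 : ℝ)).mono' (by fun_prop) (Eventually.of_forall fun ω => ?_)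
    exact (Complex.norm_exp_ofReal_mul_I _).le
  have c1 : Integrable (fun ω => (s * Complex.I) * (X ω : ℂ)) P := i1.ofReal.const_mul _
  have c2 : Integrable (fun ω => (s ^ 2 / 2 : ℂ) * ((X ω ^ 2 : ℝ) : ℂ)) P := i2.ofReal.const_mul _
  have it : Integrable (fun ω => (1 : ℂ) + (s * Complex.I) * (X ω : ℂ)
      - (s ^ 2 / 2 : ℂ) * ((X ω ^ 2 : ℝ) : ℂ)) P :=
    ((integrable_const (1 : ℂ)).fun_add c1).sub c2
  have hI : ∫ ω, ((1 : ℂ) + (s * Complex.I) * (X ω : ℂ)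
      - (s ^ 2 / 2 : ℂ) * ((X ω ^ 2 : ℝ) : ℂ)) ∂P = 1 - s ^ 2 / 2 := by
    rw [integral_sub ((integrable_const (1 : ℂ)).fun_add c1) c2,
      integral_add (integrable_const (1 : ℂ)) c1, integral_const_mul, integral_const_mul,
      integral_complex_ofReal, integral_complex_ofReal, h0, h2]
    simp
  have hcf : charFun (P.map X) s = ∫ ω, Complex.exp ((s * X ω : ℝ) * Complex.I) ∂P := by
    rw [charFun_apply_real, integral_map hX.aemeasurable (by fun_prop)]
    simp
  have step1 : ‖charFun (P.map X) s - (1 - s ^ 2 / 2)‖ ≤ 4 * (1 + B) * |s| ^ 3 := by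
    rw [hcf, ← hI, ← integral_sub ie it]
    calc _ ≤ ∫ ω, 4 * |s| ^ 3 * (1 + X ω ^ 4) ∂P := by
          refine norm_integral_le_of_norm_le
            (((integrable_const (1 : ℝ)).fun_add i4).const_mul (4 * |s| ^ 3))
            (Eventually.of_forall fun ω => ?_)
          have h := Complex.norm_exp_mul_I_sub_taylor_two_le (s * X ω)
          have e : (1 : ℂ) + (s * Complex.I) * (X ω : ℂ) - (s ^ 2 / 2 : ℂ) * ((X ω ^ 2 : ℝ) : ℂ)
              = 1 + ((s * X ω : ℝ) : ℂ) * Complex.I - ((s * X ω : ℝ) : ℂ) ^ 2 / 2 := by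
            push_cast; ring
          rw [e]
          refine h.trans ?_
          rw [abs_mul, mul_pow, mul_assoc]
          gcongr
          have : X ω ^ 4 = |X ω| ^ 4 := by rw [← abs_pow, abs_of_nonneg (by positivity)]
          rw [this]
          rcases le_total |X ω| 1 with hx | hx
          · have := pow_le_one₀ (n := 3) (abs_nonneg _) hx
            have : 0 ≤ |X ω| ^ 4 := by positivity
            linarith
          · have := pow_le_pow_right₀ hx (show 3 ≤ 4 by norm_num)
            linarith
      _ = 4 * |s| ^ 3 * (1 + ∫ ω, X ω ^ 4 ∂P) := by
          rw [integral_const_mul, integral_add (integrable_const _) i4]; simp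
      _ ≤ 4 * |s| ^ 3 * (1 + B) := by gcongr
      _ = _ := by ring
  have step2 : ‖(1 - s ^ 2 / 2 : ℂ) - Complex.exp (-(s ^ 2) / 2)‖ ≤ |s| ^ 3 := by
    have hs2 : s ^ 2 ≤ 1 := by rw [← sq_abs]; exact pow_le_one₀ (abs_nonneg _) hs
    have h := Real.norm_exp_sub_one_sub_id_le (x := -(s ^ 2) / 2) (by
      rw [Real.norm_eq_abs, abs_le]; constructor <;> nlinarith [sq_nonneg s])
    have e : (1 - s ^ 2 / 2 : ℂ) - Complex.exp (-(s ^ 2) / 2)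
        = ((-(Real.exp (-(s ^ 2) / 2) - 1 - (-(s ^ 2) / 2)) : ℝ) : ℂ) := by
      push_cast; ring
    rw [e, Complex.norm_real, norm_neg]
    refine h.trans ?_
    rw [Real.norm_eq_abs, abs_div, abs_neg, abs_pow, div_pow, ← pow_mul]
    have := pow_le_pow_of_le_one (abs_nonneg s) hs (show 3 ≤ 4 by norm_num)
    have h0 : 0 ≤ |s| ^ 4 := by positivity
    norm_num
    linarith
  calc _ ≤ ‖charFun (P.map X) s - (1 - s ^ 2 / 2)‖
        + ‖(1 - s ^ 2 / 2 : ℂ) - Complex.exp (-(s ^ 2) / 2)‖ := norm_sub_le_norm_sub_add_norm_sub _ _ _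
    _ ≤ _ := by linarith

end CharFun

/-! ### Quenched and annealed characteristic functions. -/

lemma charFun_quenchedLaw {N : ℕ} (w : Fin N → Fin N → ℝ) (t : ℝ) :
    charFun (quenchedLaw w : Measure ℝ) t
      = (Fintype.card (Equiv.Perm (Fin N)) : ℝ)⁻¹ •
        ∑ π, Complex.exp (t * permSum w π * Complex.I) := by
  rw [charFun_apply_real, integral_quenchedLaw]
  exact (by fun_prop : Continuous fun x : ℝ => Complex.exp (t * x * Complex.I)).aestronglyMeasurable

lemma charFun_quenchedLaw_eq_permAvg {N : ℕ} (w : Fin N → Fin N → ℝ) (t : ℝ) :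
    charFun (quenchedLaw w : Measure ℝ) t
      = permAvg (fun x => Real.cos (t * x)) w
        + permAvg (fun x => Real.sin (t * x)) w * Complex.I := by
  rw [charFun_quenchedLaw, permAvg, permAvg, Complex.real_smul]
  push_cast
  rw [mul_assoc, ← mul_add, Finset.sum_mul, ← Finset.sum_add_distrib]
  congr 1
  refine Finset.sum_congr rfl fun π _ => ?_
  rw [Complex.exp_mul_I]

/-- Equicontinuity in `t`, used to pass from rational to real arguments. -/
lemma norm_charFun_quenchedLaw_sub_le {N : ℕ} (w : Fin N → Fin N → ℝ) (s t : ℝ) :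
    ‖charFun (quenchedLaw w : Measure ℝ) t - charFun (quenchedLaw w : Measure ℝ) s‖
      ≤ |t - s| * permAvg (fun x => |x|) w := by
  rw [charFun_quenchedLaw, charFun_quenchedLaw, ← smul_sub, ← Finset.sum_sub_distrib, norm_smul,
    permAvg, Real.norm_of_nonneg (by positivity), mul_left_comm, Finset.mul_sum]
  gcongr
  refine norm_sum_le_of_le _ fun π _ => ?_
  set x := permSum w π
  have e : Complex.exp (t * x * Complex.I) - Complex.exp (s * x * Complex.I)
      = Complex.exp ((s * x : ℝ) * Complex.I)
        * (Complex.exp (Complex.I * ((t - s) * x : ℝ)) - 1) := by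
    rw [mul_sub, ← Complex.exp_add]
    push_cast
    ring_nf
  rw [e, norm_mul, Complex.norm_exp_ofReal_mul_I, one_mul, ← abs_mul]
  exact Real.norm_exp_I_mul_ofReal_sub_one_le

section Array

variable {Ω : Type*} [MeasurableSpace Ω] {P : Measure Ω}

lemma iIndepFun.along_perm {N : ℕ} {w : Fin N → Fin N → Ω → ℝ}
    (hindep : iIndepFun (fun a : Fin N × Fin N => w a.1 a.2) P) (π : Equiv.Perm (Fin N)) :
    iIndepFun (fun i => w i (π i)) P :=
  hindep.precomp (g := fun i => (i, π i)) fun _ _ h => (Prod.ext_iff.1 h).1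

lemma measurable_permSum {N : ℕ} {w : Fin N → Fin N → Ω → ℝ} (hmeas : ∀ i j, Measurable (w i j))
    (π : Equiv.Perm (Fin N)) : Measurable fun ω => permSum (fun i j => w i j ω) π := by
  unfold permSum
  fun_prop

lemma charFun_map_permSum {N : ℕ} {w : Fin N → Fin N → Ω → ℝ} (hmeas : ∀ i j, Measurable (w i j))
    (hindep : iIndepFun (fun a : Fin N × Fin N => w a.1 a.2) P) (π : Equiv.Perm (Fin N)) (t : ℝ) :
    charFun (P.map fun ω => permSum (fun i j => w i j ω) π) t
      = ∏ i, charFun (P.map (w i (π i))) (1 / √N * t) := by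
  unfold permSum
  rw [charFun_map_mul_comp (by fun_prop),
    (iIndepFun.along_perm hindep π).charFun_map_fun_sum_eq_prod (fun i => (hmeas _ _).aemeasurable)]
  simp

/-- The annealed characteristic function converges to the Gaussian one. -/
theorem tendsto_integral_charFun_quenchedLaw [IsProbabilityMeasure P]
    {w : (N : ℕ) → Fin N → Fin N → Ω → ℝ} {B : ℝ}
    (hmeas : ∀ N i j, Measurable (w N i j))
    (hindep : ∀ N, iIndepFun (fun a : Fin N × Fin N => w N a.1 a.2) P)
    (h4 : ∀ N i j, MemLp (w N i j) 4 P) (hmean : ∀ N i j, ∫ ω, w N i j ω ∂P = 0)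
    (hsq : ∀ N i j, ∫ ω, w N i j ω ^ 2 ∂P = 1) (hB : ∀ N i j, ∫ ω, w N i j ω ^ 4 ∂P ≤ B) (t : ℝ) :
    Tendsto (fun N => ∫ ω, charFun (quenchedLaw (fun i j => w N i j ω) : Measure ℝ) t ∂P) atTop
      (𝓝 (Complex.exp (-(t ^ 2) / 2))) := by
  have hint : ∀ N, ∫ ω, charFun (quenchedLaw (fun i j => w N i j ω) : Measure ℝ) t ∂P
      = (Fintype.card (Equiv.Perm (Fin N)) : ℝ)⁻¹ • ∑ π : Equiv.Perm (Fin N),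
        ∏ i, charFun (P.map (w N i (π i))) (1 / √N * t) := fun N => by
    have hi : ∀ π : Equiv.Perm (Fin N), Integrable (fun ω =>
        Complex.exp (t * permSum (fun i j => w N i j ω) π * Complex.I)) P := fun π => by
      have := measurable_permSum (hmeas N) π
      have hc : Continuous fun x : ℝ => Complex.exp (t * x * Complex.I) := by fun_prop
      refine (integrable_const (1 : ℝ)).mono' (hc.measurable.comp this).aestronglyMeasurable
        (Eventually.of_forall fun ω => ?_)
      rw [← Complex.ofReal_mul]
      exact (Complex.norm_exp_ofReal_mul_I _).le
    simp_rw [charFun_quenchedLaw]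
    rw [integral_smul, integral_finsetSum _ fun π _ => hi π]
    congr 1
    refine Finset.sum_congr rfl fun π _ => ?_
    rw [← charFun_map_permSum (hmeas N) (hindep N) π t, charFun_apply_real,
      integral_map (measurable_permSum (hmeas N) π).aemeasurable (by fun_prop)]
  -- The Gaussian factors as `N` copies at `s = t/√N`, so the error is at most `N` times a multiple
  -- of `|s|³`, and `N |s|³ = |t|³ / √N`. The condition `t² ≤ N` gives `|s| ≤ 1`.
  have hbound : ∀ N : ℕ, 1 ≤ N → t ^ 2 ≤ N →
      ‖∫ ω, charFun (quenchedLaw (fun i j => w N i j ω) : Measure ℝ) t ∂P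
        - Complex.exp (-(t ^ 2) / 2)‖ ≤ (5 + 4 * B) * |t| ^ 3 * (1 / √N) := fun N hN htN => by
    have hN' : (0 : ℝ) < N := by exact_mod_cast hN
    set s : ℝ := 1 / √N * t with hs
    have hss : s ^ 2 = t ^ 2 / N := by
      rw [hs, mul_pow, div_pow, Real.sq_sqrt hN'.le]; ring
    have hs1 : |s| ≤ 1 := by
      rw [← sq_le_one_iff_abs_le_one, hss, div_le_one hN']; exact htN
    have hG : Complex.exp (-(t ^ 2) / 2) = ∏ _i : Fin N, Complex.exp (-(s ^ 2) / 2) := by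
      have : (s : ℂ) ^ 2 = t ^ 2 / N := by exact_mod_cast congrArg (fun x : ℝ => (x : ℂ)) hss
      rw [Finset.prod_const, Finset.card_univ, Fintype.card_fin, ← Complex.exp_nat_mul, this]
      have : (N : ℂ) ≠ 0 := by exact_mod_cast hN'.ne'
      congr 1
      field_simp
    have hterm : ∀ π : Equiv.Perm (Fin N), ‖∏ i, charFun (P.map (w N i (π i))) s
        - Complex.exp (-(t ^ 2) / 2)‖ ≤ (5 + 4 * B) * |t| ^ 3 * (1 / √N) := fun π => by
      rw [hG]
      have hpr : ∀ i, IsProbabilityMeasure (P.map (w N i (π i))) := fun i =>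
        Measure.isProbabilityMeasure_map (hmeas _ _ _).aemeasurable
      refine (norm_prod_sub_prod_le _ (fun i _ => norm_charFun_le_one _) fun i _ => ?_).trans ?_
      · rw [show (-(s ^ 2) / 2 : ℂ) = ((-(s ^ 2) / 2 : ℝ) : ℂ) by push_cast; ring,
          Complex.norm_exp_ofReal, Real.exp_le_one_iff]
        nlinarith [sq_nonneg s]
      · refine (Finset.sum_le_sum fun i _ => norm_charFun_sub_gaussian_le (hmeas N i (π i))
          (h4 N i (π i)) (hmean N i (π i)) (hsq N i (π i)) (hB N i (π i)) hs1).trans (le_of_eq ?_)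
        have hsq3 : |s| ^ 3 = 1 / √N * |t| ^ 3 / N := by
          rw [pow_succ, sq_abs, hss, hs, abs_mul, abs_of_nonneg (by positivity),
            show |t| ^ 3 = t ^ 2 * |t| by rw [pow_succ, sq_abs]]
          ring
        rw [Finset.sum_const, Finset.card_univ, Fintype.card_fin, nsmul_eq_mul, hsq3]
        field_simp
    have hc : (0 : ℝ) < Fintype.card (Equiv.Perm (Fin N)) := by exact_mod_cast Fintype.card_pos
    have e : ∀ z : ℂ, z = (Fintype.card (Equiv.Perm (Fin N)) : ℝ)⁻¹ •
        ∑ _π : Equiv.Perm (Fin N), z := fun z => by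
      rw [Finset.sum_const, Finset.card_univ, ← Nat.cast_smul_eq_nsmul ℝ, smul_smul,
        inv_mul_cancel₀ hc.ne', one_smul]
    rw [hint, e (Complex.exp (-(t ^ 2) / 2)), ← smul_sub, ← Finset.sum_sub_distrib, norm_smul,
      Real.norm_of_nonneg (by positivity)]
    refine (mul_le_mul_of_nonneg_left (norm_sum_le_of_le _ fun π _ => hterm π)
      (by positivity)).trans (le_of_eq ?_)
    rw [Finset.sum_const, Finset.card_univ, nsmul_eq_mul, inv_mul_cancel_left₀ hc.ne']
  rw [tendsto_iff_norm_sub_tendsto_zero]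
  refine squeeze_zero' (Eventually.of_forall fun _ => norm_nonneg _)
    (g := fun N : ℕ => (5 + 4 * B) * |t| ^ 3 * (1 / √N)) ?_ ?_
  · filter_upwards [eventually_ge_atTop 1, eventually_ge_atTop ⌈t ^ 2⌉₊] with N h1 h2
    exact hbound N h1 (Nat.ceil_le.1 h2)
  · have : Tendsto (fun N : ℕ => 1 / √(N : ℝ)) atTop (𝓝 0) := by
      simp_rw [one_div]
      exact tendsto_inv_atTop_zero.comp (Real.tendsto_sqrt_atTop.comp tendsto_natCast_atTop_atTop)
    simpa using this.const_mul ((5 + 4 * B) * |t| ^ 3)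

end Array

/-! ### From concentration to weak convergence. -/

section Array

variable {Ω : Type*} [MeasurableSpace Ω] {P : Measure Ω} [IsProbabilityMeasure P]

/-- Variances add along a permutation because its entries are independent. The bound is an equality
except at `N = 0`, where the sum is empty. -/
lemma integral_permSum_sq_le_one {N : ℕ} {w : Fin N → Fin N → Ω → ℝ}
    (hindep : iIndepFun (fun a : Fin N × Fin N => w a.1 a.2) P) (h2 : ∀ i j, MemLp (w i j) 2 P)
    (hmean : ∀ i j, ∫ ω, w i j ω ∂P = 0) (hvar : ∀ i j, variance (w i j) P = 1)
    (π : Equiv.Perm (Fin N)) :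
    MemLp (fun ω => permSum (fun i j => w i j ω) π) 2 P ∧
    ∫ ω, permSum (fun i j => w i j ω) π ^ 2 ∂P ≤ 1 := by
  have hind := iIndepFun.along_perm hindep π
  have hL : MemLp (fun ω => ∑ i, w i (π i) ω) 2 P := memLp_finsetSum _ fun i _ => h2 i (π i)
  refine ⟨hL.const_mul _, ?_⟩
  have h0 : ∫ ω, ∑ i, w i (π i) ω ∂P = 0 := by
    rw [integral_finsetSum _ fun i _ => (h2 i (π i)).integrable (by norm_num)]
    simp [hmean]
  have hv : variance (∑ i, w i (π i)) P = N := by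
    rw [IndepFun.variance_sum (fun i _ => h2 i (π i)) fun i _ j _ hij => hind.indepFun hij]
    simp [hvar]
  have hsum : ∑ i, w i (π i) = fun ω => ∑ i, w i (π i) ω := by ext ω; simp
  rw [hsum, variance_of_integral_eq_zero hL.aemeasurable h0] at hv
  simp_rw [permSum, mul_pow]
  rw [integral_const_mul, hv, div_pow, Real.sq_sqrt (Nat.cast_nonneg _)]
  rcases Nat.eq_zero_or_pos N with rfl | hN
  · simp
  · have hN' : (0 : ℝ) < N := by exact_mod_cast hN
    exact le_of_eq (by field_simp)

lemma integral_permAvg_abs_le_one {N : ℕ} {w : Fin N → Fin N → Ω → ℝ}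
    (hindep : iIndepFun (fun a : Fin N × Fin N => w a.1 a.2) P) (h2 : ∀ i j, MemLp (w i j) 2 P)
    (hmean : ∀ i j, ∫ ω, w i j ω ∂P = 0) (hvar : ∀ i j, variance (w i j) P = 1) :
    ∫ ω, permAvg (fun x => |x|) (fun i j => w i j ω) ∂P ≤ 1 := by
  have key := integral_permSum_sq_le_one hindep h2 hmean hvar
  have hle : ∀ π : Equiv.Perm (Fin N), ∫ ω, |permSum (fun i j => w i j ω) π| ∂P ≤ 1 := fun π => by
    obtain ⟨hL, hk⟩ := key π
    calc _ ≤ ∫ ω, (1 / 2 : ℝ) * (1 + permSum (fun i j => w i j ω) π ^ 2) ∂P := by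
          refine integral_mono_of_nonneg (Eventually.of_forall fun ω => abs_nonneg _)
            (((integrable_const 1).fun_add hL.integrable_sq).const_mul _)
            (Eventually.of_forall fun ω => ?_)
          dsimp only
          rw [← sq_abs]
          nlinarith [sq_nonneg (|permSum (fun i j => w i j ω) π| - 1)]
      _ = (1 / 2 : ℝ) * (1 + ∫ ω, permSum (fun i j => w i j ω) π ^ 2 ∂P) := by
          rw [integral_const_mul, integral_add (integrable_const _) hL.integrable_sq]; simp
      _ ≤ 1 := by linarith
  have hc : (0 : ℝ) < Fintype.card (Equiv.Perm (Fin N)) := by exact_mod_cast Fintype.card_pos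
  unfold permAvg
  rw [integral_const_mul,
    integral_finsetSum _ fun π _ => ((key π).1.integrable (by norm_num)).abs]
  calc _ ≤ (Fintype.card (Equiv.Perm (Fin N)) : ℝ)⁻¹ * ∑ _π : Equiv.Perm (Fin N), (1 : ℝ) := by
        gcongr with π; exact hle π
    _ = 1 := by simp [hc.ne']

variable {w : (N : ℕ) → Fin N → Fin N → Ω → ℝ} {B : ℝ}

/-- Quenched combinatorial central limit theorem for independent weights with uniformly bounded
fourth moments. -/
theorem ae_tendsto_quenchedLaw (hmeas : ∀ N i j, Measurable (w N i j))
    (hindep : ∀ N, iIndepFun (fun a : Fin N × Fin N => w N a.1 a.2) P)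
    (h4 : ∀ N i j, MemLp (w N i j) 4 P) (hB : ∀ N i j, ∫ ω, w N i j ω ^ 4 ∂P ≤ B)
    (hmean : ∀ N i j, ∫ ω, w N i j ω ∂P = 0) (hvar : ∀ N i j, variance (w N i j) P = 1) :
    ∀ᵐ ω ∂P, Tendsto (fun N : ℕ => quenchedLaw (fun i j => w N i j ω)) atTop (𝓝 stdNormal) := by
  have h2 : ∀ N i j, MemLp (w N i j) 2 P := fun N i j => (h4 N i j).mono_exponent (by norm_num)
  have hsq : ∀ N i j, ∫ ω, w N i j ω ^ 2 ∂P = 1 := fun N i j => by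
    rw [← variance_of_integral_eq_zero (hmeas N i j).aemeasurable (hmean N i j), hvar]
  have hcosL : ∀ t x y : ℝ, |Real.cos (t * x) - Real.cos (t * y)| ≤ |t| * |x - y| := fun t x y => by
    rw [← abs_mul, mul_sub]; exact Real.abs_cos_sub_cos_le _ _
  have hsinL : ∀ t x y : ℝ, |Real.sin (t * x) - Real.sin (t * y)| ≤ |t| * |x - y| := fun t x y => by
    rw [← abs_mul, mul_sub]; exact Real.abs_sin_sub_sin_le _ _
  have hcos := fun t : ℝ => integrable_permAvg_and_ae_tendsto hmeas hindep h4 hB (hcosL t)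
  have hsin := fun t : ℝ => integrable_permAvg_and_ae_tendsto hmeas hindep h4 hB (hsinL t)
  have habs := integrable_permAvg_and_ae_tendsto hmeas hindep h4 hB (h := fun x => |x|) (L := 1)
    (fun x y => by rw [one_mul]; exact abs_abs_sub_abs_le_abs_sub x y)
  -- The exceptional null set depends on the argument, so only countably many arguments are treated
  -- at once.
  have hq : ∀ᵐ ω ∂P, ∀ q : ℚ, Tendsto
      (fun N => charFun (quenchedLaw (fun i j => w N i j ω) : Measure ℝ) (q : ℝ)) atTop
      (𝓝 (Complex.exp (-((q : ℝ) ^ 2) / 2))) := by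
    refine ae_all_iff.2 fun q => ?_
    have hm := tendsto_integral_charFun_quenchedLaw hmeas hindep h4 hmean hsq hB (q : ℝ)
    filter_upwards [(hcos q).2, (hsin q).2] with ω hc hs
    have hc' := (Complex.continuous_ofReal.tendsto 0).comp hc
    have hs' := ((Complex.continuous_ofReal.tendsto 0).comp hs).mul_const Complex.I
    have := (hc'.add hs').add hm
    simp only [Complex.ofReal_zero, zero_mul, zero_add] at this
    refine this.congr fun N => ?_
    simp_rw [charFun_quenchedLaw_eq_permAvg]
    rw [integral_add ((hcos q).1 N).ofReal (((hsin q).1 N).ofReal.mul_const _),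
      integral_mul_const, integral_complex_ofReal, integral_complex_ofReal]
    simp only [Function.comp]
    push_cast
    ring
  filter_upwards [hq, habs.2] with ω hq ha
  refine ProbabilityMeasure.tendsto_of_tendsto_charFun fun t => ?_
  have hG : charFun (stdNormal : Measure ℝ) t = Complex.exp (-(t ^ 2) / 2) := by
    change charFun (gaussianReal 0 1) t = _
    rw [charFun_gaussianReal]
    congr 1
    simp
    ring
  -- The annealed mean is at most 1 and the deviation from it is eventually below 1.
  have hbd : ∀ᶠ N in atTop, permAvg (fun x => |x|) (fun i j => w N i j ω) ≤ 2 := by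
    filter_upwards [ha.eventually (gt_mem_nhds zero_lt_one)] with N hN
    have := integral_permAvg_abs_le_one (hindep N) (h2 N) (hmean N) (hvar N)
    linarith
  rw [hG, Metric.tendsto_atTop']
  have hcont : Continuous fun s : ℝ => Complex.exp (-((s : ℂ) ^ 2) / 2) := by fun_prop
  intro ε hε
  obtain ⟨δ, hδ, hδε⟩ := Metric.continuous_iff.1 hcont t (ε / 3) (by positivity)
  -- The quenched characteristic functions are eventually 2-Lipschitz, so distance `ε / 6` costs at
  -- most `ε / 3`; `δ` handles the Gaussian side.
  obtain ⟨q, hq1, hq2⟩ := exists_rat_btwn (show t < t + min δ (ε / 6) by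
    have : 0 < min δ (ε / 6) := lt_min hδ (by positivity)
    linarith)
  have hqt : |(q : ℝ) - t| < min δ (ε / 6) := by rw [abs_of_pos (by linarith)]; linarith
  have e1 := hδε q (by rw [Real.dist_eq]; exact hqt.trans_le (min_le_left _ _))
  have hev : ∀ᶠ N : ℕ in atTop,
      dist (charFun (quenchedLaw (fun i j => w N i j ω) : Measure ℝ) t)
        (Complex.exp (-(t ^ 2) / 2)) < ε := by
    filter_upwards [hbd, Metric.tendsto_nhds.1 (hq q) (ε / 3) (by positivity)] with N hN hqN
    have e2 := norm_charFun_quenchedLaw_sub_le (fun i j => w N i j ω) (q : ℝ) t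
    rw [← dist_eq_norm, abs_sub_comm] at e2
    have e3 : |(q : ℝ) - t| * permAvg (fun x => |x|) (fun i j => w N i j ω) ≤ |(q : ℝ) - t| * 2 :=
      mul_le_mul_of_nonneg_left hN (abs_nonneg _)
    have e4 := hqt.trans_le (min_le_right _ _)
    have := dist_triangle4 (charFun (quenchedLaw (fun i j => w N i j ω) : Measure ℝ) t)
      (charFun (quenchedLaw (fun i j => w N i j ω) : Measure ℝ) q)
      (Complex.exp (-((q : ℝ) ^ 2) / 2)) (Complex.exp (-(t ^ 2) / 2))
    linarith
  obtain ⟨n, hn⟩ := eventually_atTop.1 hev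
  exact ⟨n, fun N hN => hn N hN.le⟩

lemma convergesWIP_of_ae_tendsto (hmeas : ∀ N i j, Measurable (w N i j)) {ν : ProbabilityMeasure ℝ}
    (h : ∀ᵐ ω ∂P, Tendsto (fun N : ℕ => quenchedLaw (fun i j => w N i j ω)) atTop (𝓝 ν)) :
    ConvergesWIP P (fun N ω => quenchedLaw (fun i j => w N i j ω)) ν := by
  intro f ε hε
  have hm : ∀ N, Measurable fun ω =>
      ∫ x, f x ∂(quenchedLaw (fun i j => w N i j ω) : Measure ℝ) := fun N => by
    simp_rw [integral_quenchedLaw_real _ f.continuous, permAvg]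
    refine (Finset.measurable_sum _ fun π _ => ?_).const_mul _
    exact f.continuous.measurable.comp (measurable_permSum (hmeas N) π)
  have hT : TendstoInMeasure P (fun (N : ℕ) ω =>
      ∫ x, f x ∂(quenchedLaw (fun i j => w N i j ω) : Measure ℝ)) atTop
      fun _ => ∫ x, f x ∂(ν : Measure ℝ) := by
    refine tendstoInMeasure_of_tendsto_ae (fun N => (hm N).aestronglyMeasurable) ?_
    filter_upwards [h] with ω hω
    exact (ProbabilityMeasure.tendsto_iff_forall_integral_tendsto.1 hω) f
  rw [tendstoInMeasure_iff_norm] at hT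
  refine tendsto_of_tendsto_of_tendsto_of_le_of_le tendsto_const_nhds (hT ε hε)
    (fun _ => zero_le) fun N => measure_mono fun ω hω => ?_
  simp only [Set.mem_ofPred_eq, Real.norm_eq_abs] at hω ⊢
  exact hω.le

end Array

lemma pow_four_le_one_add_rpow {p : ℝ} (hp : 4 ≤ p) (x : ℝ) : x ^ 4 ≤ 1 + |x| ^ p := by
  have h : x ^ 4 = |x| ^ 4 := by rw [← abs_pow, abs_of_nonneg (by positivity)]
  have h0 : 0 ≤ |x| ^ p := by positivity
  rw [h]
  rcases le_total |x| 1 with hx | hx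
  · have := pow_le_one₀ (n := 4) (abs_nonneg x) hx
    linarith
  · have := Real.rpow_le_rpow_of_exponent_le hx hp
    rw [show (4 : ℝ) = ((4 : ℕ) : ℝ) by norm_num, Real.rpow_natCast] at this
    linarith

theorem theorem1p5 {Ω : Type*} [MeasurableSpace Ω] (P : Measure Ω) [IsProbabilityMeasure P]
    (w : (N : ℕ) → Fin N → Fin N → Ω → ℝ) (p K : ℝ)
    (hmeas : ∀ N i j, Measurable (w N i j))
    (hindep : ∀ N, iIndepFun (fun a : Fin N × Fin N => w N a.1 a.2) P)
    (hmean : ∀ N i j, ∫ ω, w N i j ω ∂P = 0)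
    (hvar : ∀ N i j, variance (w N i j) P = 1)
    (hmom : ∀ N i j, Integrable (fun ω => |w N i j ω| ^ p) P ∧ ∫ ω, |w N i j ω| ^ p ∂P < K) :
    (4 < p → ConvergesWIP P (fun N ω => quenchedLaw (fun i j => w N i j ω)) stdNormal) ∧
    (6 < p → ∀ᵐ ω ∂P,
      Tendsto (fun N : ℕ => quenchedLaw (fun i j => w N i j ω)) atTop (𝓝 stdNormal)) := by
  -- Since `x⁴ ≤ 1 + |x|^p`, the fourth moments are bounded by `1 + K`. Almost sure convergence thus
  -- already holds for `p > 4`, which gives both parts.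
  have key : 4 < p → ∀ᵐ ω ∂P,
      Tendsto (fun N : ℕ => quenchedLaw (fun i j => w N i j ω)) atTop (𝓝 stdNormal) := by
    intro hp
    have hi : ∀ N i j, Integrable (fun ω => 1 + |w N i j ω| ^ p) P := fun N i j =>
      (integrable_const 1).fun_add (hmom N i j).1
    have h4 : ∀ N i j, MemLp (w N i j) 4 P := fun N i j => by
      rw [← integrable_norm_rpow_iff (hmeas N i j).aestronglyMeasurable (by norm_num) (by norm_num)]
      refine (hi N i j).mono' ((hmeas N i j).norm.pow_const _).aestronglyMeasurable
        (Eventually.of_forall fun ω => ?_)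
      have := pow_four_le_one_add_rpow hp.le (w N i j ω)
      rw [Real.norm_of_nonneg (by positivity)]
      refine le_trans (le_of_eq ?_) this
      rw [show (4 : ENNReal).toReal = ((4 : ℕ) : ℝ) by norm_num, Real.rpow_natCast,
        Real.norm_eq_abs, ← abs_pow, abs_of_nonneg (by positivity)]
    refine ae_tendsto_quenchedLaw (B := 1 + K) hmeas hindep h4 (fun N i j => ?_) hmean hvar
    calc _ ≤ ∫ ω, (1 + |w N i j ω| ^ p) ∂P :=
          integral_mono_of_nonneg (Eventually.of_forall fun ω => by positivity) (hi N i j)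
            (Eventually.of_forall fun ω => pow_four_le_one_add_rpow hp.le _)
      _ = 1 + ∫ ω, |w N i j ω| ^ p ∂P := by
          rw [integral_add (integrable_const 1) (hmom N i j).1]; simp
      _ ≤ 1 + K := by have := (hmom N i j).2; linarith
  exact ⟨fun hp => convergesWIP_of_ae_tendsto hmeas (key hp), fun hp => key (by linarith)⟩
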